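/- Let $n \ge 0$ and $k \ge 1$ be integers and let $0 < p < 1/2$. Let $\pi_0$ and $\pi_1$ be the Bernoulli distributions on $\{0,1\}$ with parameters $p$ and $1-p$, i.e. $\pi_0(\{1\}) = p$ and $\pi_1(\{1\}) = 1-p$. For $x \in \{0,1\}^n$ let $P_x := \bigotimes_{i=1}^n \pi_{x_i}$, a probability measure on $\{0,1\}^n$. For $f : \{0,1\}^n \to \mathbb{R}$ let $$D_i f(x) := \sup_{a \in \{0,1\}} f(x_1,\dots,x_{i-1},a,x_{i+1},\dots,x_n) - \inf_{a \in \{0,1\}} f(x_1,\dots,x_{i-1},a,x_{i+1},\dots,x_n), \qquad \Gamma(f) := \sum_{i=1}^n (D_i f)^2 .$$ For a probability measure $\rho$ on $\{0,1\}^n$ and $g \ge 0$ let $\operatorname{ent}_\rho(g) := \mathbb{E}_\rho[g \log g] - \mathbb{E}_\rho[g] \log \mathbb{E}_\rho[g]$ (with $0\log 0 = 0$), and let $C_{\mathrm{LS}}(\rho) \in [0,\infty]$ be the optimal (smallest) constant $C \ge 0$ in the log-Sobolev inequality $$\operatorname{ent}_\rho(f^2) \le 2C\, \mathbb{E}_\rho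 \Gamma(f) \qquad \text{for all } f : \{0,1\}^n \to \mathbb{R}.$$ Let $\mu$ be a probability measure on $\{0,1\}^n$ which is supported on a set of diameter at most $k$ in the Hamming metric. Then the mixture $\mu P := \sum_{x \in \{0,1\}^n} \mu(x) P_x$ satisfies the log-Sobolev inequality with constant $\frac{6k}{p^{k-1}(1-2p)} \log^2 \frac1p$; that is, $$C_{\mathrm{LS}}(\mu P) \le \frac{6k}{p^{k-1}\,(1-2p)} \, \log^2 \frac{1}{p} .$$ -/

import Mathlib

open MeasureTheory ProbabilityTheory
open scoped NNReal ENNReal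

noncomputable section

/-- The entropy `ent_ρ(g) = E_ρ(g log g) - E_ρ g log E_ρ g` of a nonnegative function `g`,
with the convention `0 log 0 = 0`. -/
def entropy {Y : Type*} [MeasurableSpace Y] (ρ : Measure Y) (g : Y → ℝ) : ℝ :=
  (∫ y, g y * Real.log (g y) ∂ρ) - (∫ y, g y ∂ρ) * Real.log (∫ y, g y ∂ρ)

/-- The logarithmic Sobolev inequality with constant `C` for the measure `ρ`, with respect to the
class `A` of test functions and the squared gradient `Γ`:
`ent_ρ(f ^ 2) ≤ 2 C E_ρ Γ(f)` for every `f ∈ A`. -/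
def SatisfiesLSI {Y : Type*} [MeasurableSpace Y] (A : Submodule ℝ (Y → ℝ))
    (Γ : (Y → ℝ) → Y → ℝ) (ρ : Measure Y) (C : ℝ) : Prop :=
  ∀ f ∈ A, entropy ρ (fun y => f y ^ 2) ≤ 2 * C * ∫ y, Γ f y ∂ρ

/-- The optimal log-Sobolev constant `C_LS(ρ)`, the infimum of the constants `C ≥ 0` for which
the logarithmic Sobolev inequality holds; it is `∞` if there is none. -/
def logSobolevConst {Y : Type*} [MeasurableSpace Y] (A : Submodule ℝ (Y → ℝ))
    (Γ : (Y → ℝ) → Y → ℝ) (ρ : Measure Y) : ℝ≥0∞ :=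
  ⨅ (C : ℝ≥0) (_ : SatisfiesLSI A Γ ρ (C : ℝ)), (C : ℝ≥0∞)

/-- The discrete gradient `D_i f (x)`: the supremum minus the infimum of `f` when the `i`-th
coordinate of `x` varies over all of `X` (for functions bounded in each coordinate). -/
def discreteGrad {ι X : Type*} [DecidableEq ι] (i : ι) (f : (ι → X) → ℝ) (x : ι → X) : ℝ :=
  (⨆ a : X, f (Function.update x i a)) - ⨅ a : X, f (Function.update x i a)

/-- The squared discrete gradient `Γ(f) = ∑ i, (D_i f) ^ 2`. -/
def discreteGamma {ι X : Type*} [Fintype ι] [DecidableEq ι] (f : (ι → X) → ℝ) (x : ι → X) : ℝ :=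
  ∑ i, discreteGrad i f x ^ 2

/-- The product measure `P_x = ⨂ i, π_{x i}` for `x ∈ {0,1}ⁿ`. -/
def productKernel {Y : Type*} [MeasurableSpace Y] (π : Fin 2 → Measure Y) {n : ℕ}
    (x : Fin n → Fin 2) : Measure (Fin n → Y) :=
  Measure.pi fun i => π (x i)

/-- The mixture `μP = ∑ x, μ(x) P_x`. -/
def mixture {Y : Type*} [MeasurableSpace Y] (π : Fin 2 → Measure Y) {n : ℕ}
    (μ : Measure (Fin n → Fin 2)) : Measure (Fin n → Y) :=
  ∑ x, μ {x} • productKernel π x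

/-- The pair `π 0 = Bernoulli(p)`, `π 1 = Bernoulli(1 - p)` of measures on `{0,1}`; the parameter
is the mass of the point `1`. -/
def bernoulliPair (p : unitInterval) : Fin 2 → Measure (Fin 2) :=
  ![bernoulliMeasure 1 0 p, bernoulliMeasure 1 0 (unitInterval.symm p)]

end

/-! By the chain rule, the entropy of `f ^ 2` under the mixture is the average of its entropies
under the `P_x`, plus the entropy under `μ` of `S x = E_{P_x} f ^ 2`. The first part is handled by
tensorizing a two-point log-Sobolev inequality.

For the second part, any two points charged by `μ` differ in at most `k` coordinates, so their
product measures are comparable up to `K = ((1 - p) / p) ^ k`. Hence `√S` stays below `√K` times its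
mean, and for such functions entropy is at most `3 + log K` times the variance
(`weightedEntropy_sq_le`). The variance of `√S` is an average of squared differences over pairs.
Comparability bounds each difference by `K` times a variance of `f` under a single `P_x`
(`sqrt_sub_sqrt_sq_le_of_le`), and the Poincaré inequality for `P_x` finishes. Its sharp constant `p
* (1 - p)` cancels one factor `1 / p` of `K`, hence the exponent `k - 1`. -/

/-! ### Finite weighted entropy -/

/-- The entropy of `g` with respect to the weights `w` on a finite type. -/
noncomputable def weightedEntropy {Ω : Type*} [Fintype Ω] (w g : Ω → ℝ) : ℝ :=
  (∑ y, w y * (g y * Real.log (g y))) - (∑ y, w y * g y) * Real.log (∑ y, w y * g y)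

/-- Weighted Cauchy–Schwarz inequality on a finite type. -/
theorem sum_weight_mul_le_sqrt_mul_sqrt {Ω : Type*} [Fintype Ω] {w : Ω → ℝ} (hw : ∀ y, 0 ≤ w y)
    (f h : Ω → ℝ) :
    ∑ y, w y * (f y * h y) ≤ √(∑ y, w y * f y ^ 2) * √(∑ y, w y * h y ^ 2) := by
  rw [← Real.sqrt_mul (Finset.sum_nonneg fun y _ => mul_nonneg (hw y) (sq_nonneg _))]
  apply Real.le_sqrt_of_sq_le
  exact Finset.sum_sq_le_sum_mul_sum_of_sq_le_mul _
    (fun y _ => mul_nonneg (hw y) (sq_nonneg _)) (fun y _ => mul_nonneg (hw y) (sq_nonneg _))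
    (fun y _ => le_of_eq (by ring))

/-- Weighted reverse triangle inequality in `ℓ²`. -/
theorem sq_sqrt_sub_sqrt_le {Ω : Type*} [Fintype Ω] {w : Ω → ℝ} (hw : ∀ y, 0 ≤ w y)
    (f h : Ω → ℝ) :
    (√(∑ y, w y * f y ^ 2) - √(∑ y, w y * h y ^ 2)) ^ 2 ≤ ∑ y, w y * (f y - h y) ^ 2 := by
  have hf : 0 ≤ ∑ y, w y * f y ^ 2 :=
    Finset.sum_nonneg fun y _ => mul_nonneg (hw y) (sq_nonneg _)
  have hh : 0 ≤ ∑ y, w y * h y ^ 2 :=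
    Finset.sum_nonneg fun y _ => mul_nonneg (hw y) (sq_nonneg _)
  have key := sum_weight_mul_le_sqrt_mul_sqrt hw f h
  have expand : ∑ y, w y * (f y - h y) ^ 2 =
      ∑ y, w y * f y ^ 2 + ∑ y, w y * h y ^ 2 - 2 * ∑ y, w y * (f y * h y) := by
    rw [Finset.mul_sum, ← Finset.sum_add_distrib, ← Finset.sum_sub_distrib]
    exact Finset.sum_congr rfl fun y _ => by ring
  rw [expand]
  nlinarith [Real.sq_sqrt hf, Real.sq_sqrt hh]

/-- Jensen's inequality for the square, with finite weights of total mass one. -/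
theorem sq_sum_weight_le {Ω : Type*} [Fintype Ω] {w : Ω → ℝ} (hw : ∀ y, 0 ≤ w y)
    (hw1 : ∑ y, w y = 1) (f : Ω → ℝ) :
    (∑ y, w y * f y) ^ 2 ≤ ∑ y, w y * f y ^ 2 := by
  have h := Finset.sum_sq_le_sum_mul_sum_of_sq_le_mul Finset.univ (r := fun y => w y * f y)
    (f := w) (g := fun y => w y * f y ^ 2) (fun y _ => hw y)
    (fun y _ => mul_nonneg (hw y) (sq_nonneg _)) (fun y _ => le_of_eq (by ring))
  rwa [hw1, one_mul] at h

theorem sum_weight_mul_sub_mean_sq {Ω : Type*} [Fintype Ω] {w : Ω → ℝ}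
    (hw1 : ∑ y, w y = 1) (f : Ω → ℝ) :
    ∑ y, w y * (f y - ∑ z, w z * f z) ^ 2 = ∑ y, w y * f y ^ 2 - (∑ z, w z * f z) ^ 2 := by
  set a := ∑ z, w z * f z with ha
  have : ∑ y, w y * (f y - a) ^ 2 =
      ∑ y, w y * f y ^ 2 - (2 * a) * ∑ y, w y * f y + a ^ 2 * ∑ y, w y := by
    clear_value a
    rw [Finset.mul_sum, Finset.mul_sum, ← Finset.sum_sub_distrib, ← Finset.sum_add_distrib]
    exact Finset.sum_congr rfl fun y _ => by ring
  rw [this, hw1, ← ha]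
  ring

theorem sum_weight_mul_sub_mean_sq_eq_sum_sum {Ω : Type*} [Fintype Ω] {w : Ω → ℝ}
    (hw1 : ∑ y, w y = 1) (f : Ω → ℝ) :
    ∑ y, w y * (f y - ∑ z, w z * f z) ^ 2 =
      (1 / 2) * ∑ y, ∑ z, w y * w z * (f y - f z) ^ 2 := by
  rw [sum_weight_mul_sub_mean_sq hw1]
  have inner (y : Ω) : ∑ z, w y * w z * (f y - f z) ^ 2 =
      w y * f y ^ 2 - 2 * (w y * f y) * (∑ z, w z * f z) + w y * ∑ z, w z * f z ^ 2 := by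
    have : w y * f y ^ 2 = w y * f y ^ 2 * ∑ z, w z := by rw [hw1, mul_one]
    rw [this, Finset.mul_sum, Finset.mul_sum, Finset.mul_sum, ← Finset.sum_sub_distrib,
      ← Finset.sum_add_distrib]
    exact Finset.sum_congr rfl fun y _ => by ring
  simp_rw [inner]
  rw [Finset.sum_add_distrib, Finset.sum_sub_distrib, ← Finset.sum_mul, ← Finset.sum_mul,
    ← Finset.mul_sum, hw1]
  ring

/-- With `t = g / a` and `log t ≤ t - 1`, the case `t ≤ 1` gives `(2 * t + 1) * (t - 1) ^ 2`. For `t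
≥ 1`, split `2 * t ^ 2 = 2 * (t - 1) ^ 2 + 2 * (2 * t - 1)`: the first piece uses `log t ≤ log M`,
the second leaves exactly `3 * (t - 1) ^ 2`. -/
theorem sq_mul_log_sq_sub_le {g a M : ℝ} (hg : 0 ≤ g) (ha : 0 < a) (hM : 1 ≤ M)
    (hgM : g ≤ M * a) :
    g ^ 2 * Real.log (g ^ 2) - g ^ 2 * Real.log (a ^ 2) - g ^ 2 + a ^ 2 ≤
      (3 + 2 * Real.log M) * (g - a) ^ 2 := by
  rcases hg.eq_or_lt with rfl | hg
  · have := Real.log_nonneg hM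
    simp only [ne_eq, OfNat.ofNat_ne_zero, not_false_eq_true, zero_pow, zero_mul, zero_sub]
    nlinarith [mul_nonneg this (sq_nonneg a), sq_nonneg a]
  obtain ⟨t, rfl⟩ : ∃ t, g = t * a := ⟨g / a, by field_simp⟩
  have ht : 0 < t := pos_of_mul_pos_left hg ha.le
  have htM : t ≤ M := le_of_mul_le_mul_right hgM ha
  have hlog : Real.log ((t * a) ^ 2) = 2 * Real.log t + Real.log (a ^ 2) := by
    rw [mul_pow, Real.log_mul (by positivity) (by positivity), Real.log_pow]
    norm_num
  have hlt : Real.log t ≤ t - 1 := Real.log_le_sub_one_of_pos ht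
  have hlM : Real.log t ≤ Real.log M := Real.log_le_log ht htM
  have hM0 := Real.log_nonneg hM
  have key : 2 * t ^ 2 * Real.log t - t ^ 2 + 1 ≤ (3 + 2 * Real.log M) * (t - 1) ^ 2 := by
    rcases le_total t 1 with h1 | h1
    · nlinarith [mul_nonneg hM0 (sq_nonneg (t - 1)), mul_le_mul_of_nonneg_left hlt (sq_nonneg t),
        mul_nonneg (sub_nonneg.2 h1) (sq_nonneg (t - 1))]
    · nlinarith [mul_le_mul_of_nonneg_right hlM (sq_nonneg (t - 1)),
        mul_le_mul_of_nonneg_left hlt (by linarith : 0 ≤ 2 * t - 1)]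
  rw [hlog]
  nlinarith [mul_le_mul_of_nonneg_right key (sq_nonneg a)]

/-- The entropy of a square is controlled by the variance, if the function is bounded by a
multiple `M` of its mean. -/
theorem weightedEntropy_sq_le {Ω : Type*} [Fintype Ω] {w : Ω → ℝ} (hw : ∀ y, 0 ≤ w y)
    (hw1 : ∑ y, w y = 1) {g : Ω → ℝ} (hg : ∀ y, 0 ≤ g y) {M : ℝ} (hM : 1 ≤ M)
    (hgM : ∀ y, w y ≠ 0 → g y ≤ M * ∑ z, w z * g z) :
    weightedEntropy w (fun y => g y ^ 2) ≤
      (3 + 2 * Real.log M) * ∑ y, w y * (g y - ∑ z, w z * g z) ^ 2 := by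
  set a := ∑ z, w z * g z with ha
  have ha0 : 0 ≤ a := Finset.sum_nonneg fun y _ => mul_nonneg (hw y) (hg y)
  have hlM := Real.log_nonneg hM
  have hV : 0 ≤ ∑ y, w y * (g y - a) ^ 2 :=
    Finset.sum_nonneg fun y _ => mul_nonneg (hw y) (sq_nonneg _)
  unfold weightedEntropy
  rcases ha0.eq_or_lt with h0 | hpos
  -- If the mean vanishes, the bound by `M` times the mean kills `g` on the support.
  · have hz (y : Ω) : w y = 0 ∨ g y = 0 := by
      by_cases h : w y = 0
      · exact Or.inl h
      · have := hgM y h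
        rw [← h0, mul_zero] at this
        exact Or.inr (le_antisymm this (hg y))
    have h1 : ∑ y, w y * (g y ^ 2 * Real.log (g y ^ 2)) = 0 :=
      Finset.sum_eq_zero fun y _ => by rcases hz y with h | h <;> simp [h]
    have h2 : ∑ y, w y * g y ^ 2 = 0 :=
      Finset.sum_eq_zero fun y _ => by rcases hz y with h | h <;> simp [h]
    rw [h1, h2]
    simpa using mul_nonneg (by positivity : 0 ≤ 3 + 2 * Real.log M) hV
  · set A := ∑ y, w y * g y ^ 2 with hA
    have hApos : 0 < A := (by positivity : 0 < a ^ 2).trans_le (sq_sum_weight_le hw hw1 g)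
    -- Entropy only grows when the mean `A` of `g ^ 2` is replaced by another reference value, here
    -- `a ^ 2`; this is `log s ≤ s - 1` at `s = a ^ 2 / A`.
    have hlog : A * Real.log (a ^ 2) + A - a ^ 2 ≤ A * Real.log A := by
      have h := Real.log_le_sub_one_of_pos (div_pos (pow_pos hpos 2) hApos)
      rw [Real.log_div (by positivity) hApos.ne'] at h
      have h' := mul_le_mul_of_nonneg_left h hApos.le
      have : A * (a ^ 2 / A - 1) = a ^ 2 - A := by field_simp
      linarith
    have hsum : ∑ y, w y * (g y ^ 2 * Real.log (g y ^ 2) - g y ^ 2 * Real.log (a ^ 2) - g y ^ 2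
        + a ^ 2) ≤ ∑ y, w y * ((3 + 2 * Real.log M) * (g y - a) ^ 2) := by
      refine Finset.sum_le_sum fun y _ => ?_
      by_cases h : w y = 0
      · simp [h]
      · exact mul_le_mul_of_nonneg_left (sq_mul_log_sq_sub_le (hg y) hpos hM (hgM y h)) (hw y)
    have hL : ∑ y, w y * (g y ^ 2 * Real.log (g y ^ 2) - g y ^ 2 * Real.log (a ^ 2) - g y ^ 2
        + a ^ 2) = ∑ y, w y * (g y ^ 2 * Real.log (g y ^ 2)) - A * Real.log (a ^ 2) - A
          + a ^ 2 := by
      have h1 : ∑ y, w y * (g y ^ 2 * Real.log (g y ^ 2)) - A * Real.log (a ^ 2) - A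
          + a ^ 2 * ∑ y, w y = ∑ y, w y * (g y ^ 2 * Real.log (g y ^ 2))
            - A * Real.log (a ^ 2) - A + a ^ 2 := by rw [hw1, mul_one]
      rw [← h1, hA]
      clear_value a
      rw [Finset.sum_mul, Finset.mul_sum, ← Finset.sum_sub_distrib, ← Finset.sum_sub_distrib,
        ← Finset.sum_add_distrib]
      exact Finset.sum_congr rfl fun y _ => by ring
    have hR : ∑ y, w y * ((3 + 2 * Real.log M) * (g y - a) ^ 2) =
        (3 + 2 * Real.log M) * ∑ y, w y * (g y - a) ^ 2 := by
      rw [Finset.mul_sum]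
      exact Finset.sum_congr rfl fun y _ => by ring
    linarith

/-- Chain rule: the entropy under a mixture of weights. -/
theorem weightedEntropy_mixture {α Ω : Type*} [Fintype α] [Fintype Ω] (m : α → ℝ)
    (W : α → Ω → ℝ) (g : Ω → ℝ) :
    weightedEntropy (fun y => ∑ x, m x * W x y) g =
      ∑ x, m x * weightedEntropy (W x) g + weightedEntropy m (fun x => ∑ y, W x y * g y) := by
  have swap (h : Ω → ℝ) : ∑ y, (∑ x, m x * W x y) * h y = ∑ x, m x * ∑ y, W x y * h y := by
    simp_rw [Finset.sum_mul, Finset.mul_sum]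
    rw [Finset.sum_comm]
    exact Finset.sum_congr rfl fun x _ => Finset.sum_congr rfl fun y _ => by ring
  unfold weightedEntropy
  rw [swap g, swap fun y => g y * Real.log (g y)]
  simp_rw [mul_sub]
  rw [Finset.sum_sub_distrib]
  ring

/-! ### Two-point weights and products -/

/-- Each atom has mass at least `p`, so `g` is at most `1 / p` times its mean. The factor `1 / 4`
bounds the product of the two masses. -/
theorem weightedEntropy_sq_two_point_le {w : Fin 2 → ℝ} {p : ℝ} (hp : 0 < p)
    (hw : ∀ a, p ≤ w a) (hw1 : w 0 + w 1 = 1) {g : Fin 2 → ℝ} (hg : ∀ a, 0 ≤ g a) :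
    weightedEntropy w (fun a => g a ^ 2) ≤
      (3 + 2 * Real.log (1 / p)) / 4 * (g 1 - g 0) ^ 2 := by
  have hw0 (a) : 0 ≤ w a := hp.le.trans (hw a)
  have hsum : ∑ a, w a = 1 := by rw [Fin.sum_univ_two, hw1]
  have hp1 : 1 ≤ 1 / p := by
    rw [le_div_iff₀ hp]
    linarith [hw 0, hw0 1]
  have h := weightedEntropy_sq_le hw0 hsum hg hp1 (fun a _ => by
    rw [div_mul_eq_mul_div, one_mul, le_div_iff₀ hp, mul_comm]
    exact (mul_le_mul_of_nonneg_right (hw a) (hg a)).trans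
      (Finset.single_le_sum (f := fun z => w z * g z)
        (fun z _ => mul_nonneg (hw0 z) (hg z)) (Finset.mem_univ a)))
  refine h.trans ?_
  have hl := Real.log_nonneg hp1
  have hv : ∑ y, w y * (g y - ∑ z, w z * g z) ^ 2 ≤ (g 1 - g 0) ^ 2 / 4 := by
    rw [sum_weight_mul_sub_mean_sq hsum, Fin.sum_univ_two, Fin.sum_univ_two]
    rw [show w 1 = 1 - w 0 by linarith]
    nlinarith [mul_nonneg (sq_nonneg (w 0 - 1 / 2)) (sq_nonneg (g 1 - g 0))]
  nlinarith [mul_le_mul_of_nonneg_left hv (by positivity : 0 ≤ 3 + 2 * Real.log (1 / p))]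

/-- The product of the weights `w i`. -/
def prodWeight {n : ℕ} (w : Fin n → Fin 2 → ℝ) (y : Fin n → Fin 2) : ℝ := ∏ i, w i (y i)

theorem prodWeight_nonneg {n : ℕ} {w : Fin n → Fin 2 → ℝ} (hw : ∀ i a, 0 ≤ w i a)
    (y : Fin n → Fin 2) : 0 ≤ prodWeight w y :=
  Finset.prod_nonneg fun i _ => hw i (y i)

theorem sum_prodWeight {n : ℕ} {w : Fin n → Fin 2 → ℝ} (hw1 : ∀ i, w i 0 + w i 1 = 1) :
    ∑ y, prodWeight w y = 1 := by
  unfold prodWeight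
  rw [← Fintype.prod_sum]
  exact Finset.prod_eq_one fun i _ => by rw [Fin.sum_univ_two, hw1]

theorem sum_prodWeight_succ {n : ℕ} (w : Fin (n + 1) → Fin 2 → ℝ)
    (g : (Fin (n + 1) → Fin 2) → ℝ) :
    ∑ y, prodWeight w y * g y =
      ∑ a, w 0 a * ∑ y, prodWeight (fun i => w i.succ) y * g (Fin.cons a y) := by
  rw [← (Fin.consEquiv fun _ : Fin (n + 1) => Fin 2).sum_comp, Fintype.sum_prod_type]
  simp_rw [Finset.mul_sum]
  refine Finset.sum_congr rfl fun a _ => Finset.sum_congr rfl fun y _ => ?_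
  simp only [Fin.consEquiv, Equiv.coe_fn_mk, prodWeight, Fin.prod_univ_succ, Fin.cons_zero,
    Fin.cons_succ]
  ring

theorem discreteGrad_sq {n : ℕ} (i : Fin n) (f : (Fin n → Fin 2) → ℝ) (y : Fin n → Fin 2) :
    discreteGrad i f y ^ 2 = (f (Function.update y i 1) - f (Function.update y i 0)) ^ 2 := by
  have hsup (h : Fin 2 → ℝ) : ⨆ a, h a = max (h 0) (h 1) := by
    apply le_antisymm
    · exact ciSup_le fun a => by fin_cases a <;> simp
    · exact max_le (le_ciSup (Set.finite_range h).bddAbove 0)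
        (le_ciSup (Set.finite_range h).bddAbove 1)
  have hinf (h : Fin 2 → ℝ) : ⨅ a, h a = min (h 0) (h 1) := by
    apply le_antisymm
    · exact le_min (ciInf_le (Set.finite_range h).bddBelow 0)
        (ciInf_le (Set.finite_range h).bddBelow 1)
    · exact le_ciInf fun a => by fin_cases a <;> simp
  unfold discreteGrad
  rw [hsup, hinf, max_sub_min_eq_abs, sq_abs]

theorem discreteGamma_cons {n : ℕ} (f : (Fin (n + 1) → Fin 2) → ℝ) (a : Fin 2)
    (y : Fin n → Fin 2) :
    discreteGamma f (Fin.cons a y) =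
      (f (Fin.cons 1 y) - f (Fin.cons 0 y)) ^ 2 + discreteGamma (fun z => f (Fin.cons a z)) y := by
  unfold discreteGamma
  simp_rw [discreteGrad_sq]
  rw [Fin.sum_univ_succ]
  simp_rw [Fin.update_cons_zero, ← Fin.cons_update]

/-- The squared gradient in coordinate `0` does not depend on that coordinate, so averaging over it
is free. -/
theorem sum_prodWeight_mul_discreteGamma_succ {n : ℕ} {w : Fin (n + 1) → Fin 2 → ℝ}
    (hw1 : w 0 0 + w 0 1 = 1) (f : (Fin (n + 1) → Fin 2) → ℝ) :
    ∑ y, prodWeight w y * discreteGamma f y =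
      ∑ y, prodWeight (fun i => w i.succ) y * (f (Fin.cons 1 y) - f (Fin.cons 0 y)) ^ 2 +
        ∑ a, w 0 a * ∑ y, prodWeight (fun i => w i.succ) y *
          discreteGamma (fun z => f (Fin.cons a z)) y := by
  rw [sum_prodWeight_succ]
  simp_rw [discreteGamma_cons, mul_add, Finset.sum_add_distrib, mul_add]
  rw [Finset.sum_add_distrib, ← Finset.sum_mul, Fin.sum_univ_two, hw1, one_mul]

/-- Tensorization of the log-Sobolev inequality from two-point factors. -/
theorem weightedEntropy_prodWeight_sq_le {c : ℝ} (hc : 0 ≤ c) {n : ℕ} {w : Fin n → Fin 2 → ℝ}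
    (hw : ∀ i a, 0 ≤ w i a) (hw1 : ∀ i, w i 0 + w i 1 = 1)
    (h2 : ∀ i (g : Fin 2 → ℝ), (∀ a, 0 ≤ g a) →
      weightedEntropy (w i) (fun a => g a ^ 2) ≤ c * (g 1 - g 0) ^ 2)
    (f : (Fin n → Fin 2) → ℝ) :
    weightedEntropy (prodWeight w) (fun y => f y ^ 2) ≤
      c * ∑ y, prodWeight w y * discreteGamma f y := by
  induction n with
  | zero =>
    simp [weightedEntropy, prodWeight, discreteGamma]
  | succ n ih =>
    set w' : Fin n → Fin 2 → ℝ := fun i => w i.succ with hw'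
    have hW' : ∀ y, 0 ≤ prodWeight w' y := prodWeight_nonneg fun i a => hw i.succ a
    set S : Fin 2 → ℝ := fun a => ∑ y, prodWeight w' y * f (Fin.cons a y) ^ 2 with hS
    have hS0 (a) : 0 ≤ S a := Finset.sum_nonneg fun y _ => mul_nonneg (hW' y) (sq_nonneg _)
    have hchain : weightedEntropy (prodWeight w) (fun y => f y ^ 2) =
        ∑ a, w 0 a * weightedEntropy (prodWeight w') (fun y => f (Fin.cons a y) ^ 2) +
          weightedEntropy (w 0) S := by
      unfold weightedEntropy
      rw [sum_prodWeight_succ, sum_prodWeight_succ]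
      simp_rw [mul_sub]
      rw [Finset.sum_sub_distrib]
      ring
    have htwo : weightedEntropy (w 0) S ≤
        c * ∑ y, prodWeight w' y * (f (Fin.cons 1 y) - f (Fin.cons 0 y)) ^ 2 := by
      -- The fibre `ℓ²` norms are the test function; the reverse triangle inequality turns their
      -- difference into the coordinate-`0` gradient.
      have h := h2 0 (fun a => √(S a)) fun a => Real.sqrt_nonneg _
      simp_rw [fun a => Real.sq_sqrt (hS0 a)] at h
      exact h.trans (mul_le_mul_of_nonneg_left (sq_sqrt_sub_sqrt_le hW' _ _) hc)
    have hfib : ∑ a, w 0 a * weightedEntropy (prodWeight w') (fun y => f (Fin.cons a y) ^ 2) ≤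
        c * ∑ a, w 0 a * ∑ y, prodWeight w' y * discreteGamma (fun z => f (Fin.cons a z)) y := by
      rw [Finset.mul_sum]
      refine Finset.sum_le_sum fun a _ => ?_
      rw [mul_left_comm]
      exact mul_le_mul_of_nonneg_left
        (ih (fun i => hw i.succ) (fun i => hw1 i.succ) (fun i => h2 i.succ) _) (hw 0 a)
    rw [hchain, sum_prodWeight_mul_discreteGamma_succ (hw1 0), mul_add]
    linarith

/-- Tensorization of the Poincaré inequality from two-point factors. -/
theorem prodWeight_variance_le {b : ℝ} {n : ℕ} {w : Fin n → Fin 2 → ℝ}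
    (hw : ∀ i a, 0 ≤ w i a) (hw1 : ∀ i, w i 0 + w i 1 = 1) (hb : ∀ i, w i 0 * w i 1 ≤ b)
    (hb0 : 0 ≤ b) (f : (Fin n → Fin 2) → ℝ) :
    ∑ y, prodWeight w y * f y ^ 2 - (∑ y, prodWeight w y * f y) ^ 2 ≤
      b * ∑ y, prodWeight w y * discreteGamma f y := by
  induction n with
  | zero =>
    simp [prodWeight, discreteGamma]
  | succ n ih =>
    set w' : Fin n → Fin 2 → ℝ := fun i => w i.succ with hw'
    have hW' : ∀ y, 0 ≤ prodWeight w' y := prodWeight_nonneg fun i a => hw i.succ a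
    have hW1 : ∑ y, prodWeight w' y = 1 := sum_prodWeight fun i => hw1 i.succ
    set e : Fin 2 → ℝ := fun a => ∑ y, prodWeight w' y * f (Fin.cons a y) with he
    have hfib (a : Fin 2) := mul_le_mul_of_nonneg_left
      (ih (fun i => hw i.succ) (fun i => hw1 i.succ) (fun i => hb i.succ)
        fun y => f (Fin.cons a y)) (hw 0 a)
    have hjen : (e 1 - e 0) ^ 2 ≤
        ∑ y, prodWeight w' y * (f (Fin.cons 1 y) - f (Fin.cons 0 y)) ^ 2 := by
      have h := sq_sum_weight_le hW' hW1 fun y => f (Fin.cons 1 y) - f (Fin.cons 0 y)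
      simp_rw [mul_sub] at h
      rwa [Finset.sum_sub_distrib] at h
    have hjen' := mul_le_mul_of_nonneg_left hjen hb0
    have hbe := mul_le_mul_of_nonneg_right (hb 0) (sq_nonneg (e 1 - e 0))
    rw [sum_prodWeight_mul_discreteGamma_succ (hw1 0), sum_prodWeight_succ, sum_prodWeight_succ]
    simp only [Fin.sum_univ_two]
    have h0 := hfib 0
    have h1 := hfib 1
    have hsplit : w 0 0 * e 0 ^ 2 + w 0 1 * e 1 ^ 2 - (w 0 0 * e 0 + w 0 1 * e 1) ^ 2 =
        w 0 0 * w 0 1 * (e 1 - e 0) ^ 2 := by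
      rw [show w 0 1 = 1 - w 0 0 by linarith [hw1 0]]
      ring
    simp only [he] at *
    linarith

/-! ### Mixtures -/

/-- Let `m` be the mean of `f` under `v`. Since `|m|` is below the `v`-norm of `f`, hence below its
`w`-norm, replacing the `v`-norm by `|m|` only widens the gap. The triangle inequality in `ℓ²(w)`
then gives `∑ w (f - m) ^ 2`, which is at most `K` times the variance under `v`. -/
theorem sqrt_sub_sqrt_sq_le_of_le {Ω : Type*} [Fintype Ω] {w v : Ω → ℝ} (hw : ∀ y, 0 ≤ w y)
    (hv : ∀ y, 0 ≤ v y) (hw1 : ∑ y, w y = 1) (hv1 : ∑ y, v y = 1) {K : ℝ}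
    (hK : ∀ y, w y ≤ K * v y) (f : Ω → ℝ)
    (hle : √(∑ y, v y * f y ^ 2) ≤ √(∑ y, w y * f y ^ 2)) :
    (√(∑ y, w y * f y ^ 2) - √(∑ y, v y * f y ^ 2)) ^ 2 ≤
      K * (∑ y, v y * f y ^ 2 - (∑ y, v y * f y) ^ 2) := by
  set m := ∑ y, v y * f y with hm
  have h1 := sq_sqrt_sub_sqrt_le hw f fun _ => m
  have hc : √(∑ y, w y * m ^ 2) = |m| := by
    rw [← Finset.sum_mul, hw1, one_mul, Real.sqrt_sq_eq_abs]
  rw [hc] at h1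
  have hmv : |m| ≤ √(∑ y, v y * f y ^ 2) := by
    rw [← Real.sqrt_sq_eq_abs]
    exact Real.sqrt_le_sqrt (sq_sum_weight_le hv hv1 f)
  have h2 : ∑ y, w y * (f y - m) ^ 2 ≤ K * ∑ y, v y * (f y - m) ^ 2 := by
    rw [Finset.mul_sum]
    refine Finset.sum_le_sum fun y _ => ?_
    rw [← mul_assoc]
    exact mul_le_mul_of_nonneg_right (hK y) (sq_nonneg _)
  rw [sum_weight_mul_sub_mean_sq hv1] at h2
  refine (pow_le_pow_left₀ (sub_nonneg.2 hle) (by linarith) 2).trans (h1.trans h2)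

/-- Log-Sobolev inequality for a mixture of mutually comparable weights, each of which satisfies
a log-Sobolev and a Poincaré inequality. -/
theorem weightedEntropy_mixture_sq_le {α Ω : Type*} [Fintype α] [Fintype Ω] {m : α → ℝ}
    {W : α → Ω → ℝ} (hm : ∀ x, 0 ≤ m x) (hm1 : ∑ x, m x = 1) (hW : ∀ x y, 0 ≤ W x y)
    (hW1 : ∀ x, ∑ y, W x y = 1) {K : ℝ} (hK1 : 1 ≤ K)
    (hK : ∀ x x', m x ≠ 0 → m x' ≠ 0 → ∀ y, W x y ≤ K * W x' y) {f G : Ω → ℝ} {b c : ℝ}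
    (hls : ∀ x, weightedEntropy (W x) (fun y => f y ^ 2) ≤ c * ∑ y, W x y * G y)
    (hP : ∀ x, ∑ y, W x y * f y ^ 2 - (∑ y, W x y * f y) ^ 2 ≤ b * ∑ y, W x y * G y) :
    weightedEntropy (fun y => ∑ x, m x * W x y) (fun y => f y ^ 2) ≤
      (c + (3 + Real.log K) * (K * b)) * ∑ y, (∑ x, m x * W x y) * G y := by
  have hK0 : 0 < K := by linarith
  set S : α → ℝ := fun x => ∑ y, W x y * f y ^ 2 with hS
  have hS0 (x) : 0 ≤ S x := Finset.sum_nonneg fun y _ => mul_nonneg (hW x y) (sq_nonneg _)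
  set E : α → ℝ := fun x => ∑ y, W x y * G y with hE
  have hmix : ∑ y, (∑ x, m x * W x y) * G y = ∑ x, m x * E x := by
    simp_rw [hE, Finset.sum_mul, Finset.mul_sum]
    rw [Finset.sum_comm]
    exact Finset.sum_congr rfl fun x _ => Finset.sum_congr rfl fun y _ => by ring
  have hfirst : ∑ x, m x * weightedEntropy (W x) (fun y => f y ^ 2) ≤ c * ∑ x, m x * E x := by
    rw [Finset.mul_sum]
    refine Finset.sum_le_sum fun x _ => ?_
    rw [mul_left_comm]
    exact mul_le_mul_of_nonneg_left (hls x) (hm x)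
  have hratio (x x') (hx : m x ≠ 0) (hx' : m x' ≠ 0) : √(S x) ≤ √K * √(S x') := by
    rw [← Real.sqrt_mul hK0.le]
    refine Real.sqrt_le_sqrt ?_
    rw [hS, Finset.mul_sum]
    refine Finset.sum_le_sum fun y _ => ?_
    rw [← mul_assoc]
    exact mul_le_mul_of_nonneg_right (hK x x' hx hx' y) (sq_nonneg _)
  have hmean (x) (hx : m x ≠ 0) : √(S x) ≤ √K * ∑ x', m x' * √(S x') := by
    calc √(S x) = ∑ x', m x' * √(S x) := by rw [← Finset.sum_mul, hm1, one_mul]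
      _ ≤ ∑ x', m x' * (√K * √(S x')) := by
        refine Finset.sum_le_sum fun x' _ => ?_
        by_cases hx' : m x' = 0
        · simp [hx']
        · exact mul_le_mul_of_nonneg_left (hratio x x' hx hx') (hm x')
      _ = √K * ∑ x', m x' * √(S x') := by
        rw [Finset.mul_sum]
        exact Finset.sum_congr rfl fun x' _ => by ring
  have hsecond := weightedEntropy_sq_le hm hm1 (fun x => Real.sqrt_nonneg (S x))
    (Real.one_le_sqrt.2 hK1) hmean
  simp_rw [fun x => Real.sq_sqrt (hS0 x)] at hsecond
  have hvar0 (x) : 0 ≤ S x - (∑ y, W x y * f y) ^ 2 :=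
    sub_nonneg.2 (sq_sum_weight_le (hW x) (hW1 x) f)
  have hpair (x x') (hx : m x ≠ 0) (hx' : m x' ≠ 0) :
      (√(S x) - √(S x')) ^ 2 ≤ K * (b * E x + b * E x') := by
    -- Only the variance at the point with the smaller norm is needed; the other is added to make
    -- the bound symmetric.
    have hle (x x') (hx : m x ≠ 0) (hx' : m x' ≠ 0) (h : √(S x') ≤ √(S x)) :
        (√(S x) - √(S x')) ^ 2 ≤ K * (b * E x + b * E x') := by
      refine (sqrt_sub_sqrt_sq_le_of_le (hW x) (hW x') (hW1 x) (hW1 x') (hK x x' hx hx') f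
        h).trans (mul_le_mul_of_nonneg_left ?_ hK0.le)
      linarith [hP x, hP x', hvar0 x]
    rcases le_total (√(S x')) (√(S x)) with h | h
    · exact hle x x' hx hx' h
    · rw [← neg_sub, neg_sq, add_comm]
      exact hle x' x hx' hx h
  have hvar : ∑ x, m x * (√(S x) - ∑ z, m z * √(S z)) ^ 2 ≤ K * b * ∑ x, m x * E x := by
    rw [sum_weight_mul_sub_mean_sq_eq_sum_sum hm1]
    have hsum : ∑ x, ∑ x', m x * m x' * (√(S x) - √(S x')) ^ 2 ≤
        ∑ x, ∑ x', (K * b * (m x * E x) * m x' + K * b * m x * (m x' * E x')) := by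
      refine Finset.sum_le_sum fun x _ => Finset.sum_le_sum fun x' _ => ?_
      by_cases hx : m x = 0
      · simp [hx]
      by_cases hx' : m x' = 0
      · simp [hx']
      refine (mul_le_mul_of_nonneg_left (hpair x x' hx hx')
        (mul_nonneg (hm x) (hm x'))).trans (le_of_eq (by ring))
    simp_rw [Finset.sum_add_distrib, ← Finset.mul_sum, hm1, mul_one, ← Finset.sum_mul,
      ← Finset.mul_sum, hm1, mul_one] at hsum
    linarith
  -- The ratio bound applied to norms is `√K`, which absorbs the factor `2` in `3 + 2 * log M`.
  have hl : 2 * Real.log √K = Real.log K := by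
    rw [Real.log_sqrt hK0.le]
    ring
  rw [hl] at hsecond
  have h3 : 0 ≤ 3 + Real.log K := by linarith [Real.log_nonneg hK1]
  rw [weightedEntropy_mixture, hmix]
  linarith [mul_le_mul_of_nonneg_left hvar h3]

/-- The product weights attached to two points at Hamming distance `d` are comparable up to the
factor `r ^ d`, if the two one-coordinate weights are comparable up to the factor `r`. -/
theorem prodWeight_le_pow_hammingDist_mul {n : ℕ} {v : Fin 2 → Fin 2 → ℝ} {r : ℝ}
    (hv : ∀ a b, 0 ≤ v a b) (hr : ∀ a a' b, v a b ≤ r * v a' b) (x x' y : Fin n → Fin 2) :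
    prodWeight (fun i => v (x i)) y ≤
      r ^ hammingDist x x' * prodWeight (fun i => v (x' i)) y := by
  have hpow : r ^ hammingDist x x' = ∏ i, if x i ≠ x' i then r else 1 := by
    rw [Finset.prod_ite, Finset.prod_const, Finset.prod_const_one, mul_one]
    rfl
  unfold prodWeight
  rw [hpow, ← Finset.prod_mul_distrib]
  refine Finset.prod_le_prod (fun i _ => hv _ _) fun i _ => ?_
  split_ifs with h
  · exact hr _ _ _
  · simp only [not_not.1 h, one_mul, le_refl]

/-! ### Bernoulli weights -/

theorem isFiniteMeasure_bernoulliPair (p : unitInterval) (a : Fin 2) :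
    IsFiniteMeasure (bernoulliPair p a) := by
  fin_cases a <;> simp only [bernoulliPair] <;> simp <;> infer_instance

theorem bernoulliPair_real_singleton (p : unitInterval) (a b : Fin 2) :
    (bernoulliPair p a).real {b} = if a = b then 1 - (p : ℝ) else p := by
  fin_cases a <;> fin_cases b <;>
    simp [bernoulliPair]

theorem productKernel_real_singleton (p : unitInterval) {n : ℕ} (x y : Fin n → Fin 2) :
    (productKernel (bernoulliPair p) x).real {y} =
      prodWeight (fun i b => if x i = b then 1 - (p : ℝ) else p) y := by
  have := isFiniteMeasure_bernoulliPair p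
  rw [productKernel, measureReal_def, Measure.pi_singleton, ENNReal.toReal_prod]
  exact Finset.prod_congr rfl fun i _ => bernoulliPair_real_singleton p (x i) (y i)

theorem isFiniteMeasure_mixture (p : unitInterval) {n : ℕ} (μ : Measure (Fin n → Fin 2))
    [IsFiniteMeasure μ] : IsFiniteMeasure (mixture (bernoulliPair p) μ) := by
  have := isFiniteMeasure_bernoulliPair p
  have (x : Fin n → Fin 2) : IsFiniteMeasure (productKernel (bernoulliPair p) x) := by
    unfold productKernel
    infer_instance
  constructor
  simp only [mixture, Measure.coe_finsetSum, Finset.sum_apply, Measure.smul_apply, smul_eq_mul]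
  exact ENNReal.sum_lt_top.2 fun x _ => ENNReal.mul_lt_top (measure_lt_top _ _) (measure_lt_top _ _)

theorem mixture_real_singleton (p : unitInterval) {n : ℕ} (μ : Measure (Fin n → Fin 2))
    [IsFiniteMeasure μ] (y : Fin n → Fin 2) :
    (mixture (bernoulliPair p) μ).real {y} =
      ∑ x, μ.real {x} * prodWeight (fun i b => if x i = b then 1 - (p : ℝ) else p) y := by
  have := isFiniteMeasure_bernoulliPair p
  have (x : Fin n → Fin 2) : IsFiniteMeasure (productKernel (bernoulliPair p) x) := by
    unfold productKernel
    infer_instance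
  simp_rw [← productKernel_real_singleton]
  simp only [mixture, measureReal_def, Measure.coe_finsetSum, Finset.sum_apply,
    Measure.smul_apply, smul_eq_mul]
  rw [ENNReal.toReal_sum fun x _ => ENNReal.mul_ne_top (measure_ne_top _ _) (measure_ne_top _ _)]
  simp_rw [ENNReal.toReal_mul]

theorem integral_eq_sum_real_singleton {Ω : Type*} [Fintype Ω] [MeasurableSpace Ω]
    [MeasurableSingletonClass Ω] (ρ : Measure Ω) [IsFiniteMeasure ρ] (g : Ω → ℝ) :
    ∫ y, g y ∂ρ = ∑ y, ρ.real {y} * g y :=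
  integral_fintype Integrable.of_finite

theorem entropy_eq_weightedEntropy {Ω : Type*} [Fintype Ω] [MeasurableSpace Ω]
    [MeasurableSingletonClass Ω] (ρ : Measure Ω) [IsFiniteMeasure ρ] (g : Ω → ℝ) :
    entropy ρ g = weightedEntropy (fun y => ρ.real {y}) g := by
  simp only [entropy, weightedEntropy, integral_eq_sum_real_singleton]

theorem mixture_constant_le {k : ℕ} (hk : 1 ≤ k) {p : ℝ} (hp0 : 0 < p) (hp : p < 1 / 2) :
    (3 + 2 * Real.log (1 / p)) / 4 +
        (3 + Real.log (((1 - p) / p) ^ k)) * (((1 - p) / p) ^ k * (p * (1 - p))) ≤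
      2 * (6 * (k : ℝ) / (p ^ (k - 1) * (1 - 2 * p)) * Real.log (1 / p) ^ 2) := by
  obtain ⟨j, rfl⟩ : ∃ j, k = j + 1 := ⟨k - 1, by omega⟩
  set L := Real.log (1 / p) with hL
  set D : ℝ := (1 / p) ^ j with hD
  have hp1 : 1 ≤ 1 / p := by
    rw [le_div_iff₀ hp0]
    linarith
  have hD1 : 1 ≤ D := one_le_pow₀ hp1
  have hL0 : 0.69 ≤ L := by
    have h2 : Real.log 2 ≤ L := Real.log_le_log (by norm_num) (by
      rw [le_div_iff₀ hp0]
      linarith)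
    linarith [Real.log_two_gt_d9]
  have hr0 : 0 < (1 - p) / p := div_pos (by linarith) hp0
  have hr : (1 - p) / p ≤ 1 / p := div_le_div_of_nonneg_right (by linarith) hp0.le
  have hlog : Real.log (((1 - p) / p) ^ (j + 1)) ≤ (j + 1 : ℕ) * L := by
    rw [Real.log_pow]
    exact mul_le_mul_of_nonneg_left (Real.log_le_log hr0 hr) (Nat.cast_nonneg _)
  have hr1 : 1 ≤ (1 - p) / p := by
    rw [le_div_iff₀ hp0]
    linarith
  have hlog0 : 0 ≤ Real.log (((1 - p) / p) ^ (j + 1)) := Real.log_nonneg (one_le_pow₀ hr1)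
  -- The Poincaré factor `p` lowers the power of `1 / p` from `k` to `k - 1`.
  have hKb : ((1 - p) / p) ^ (j + 1) * (p * (1 - p)) ≤ D := by
    calc ((1 - p) / p) ^ (j + 1) * (p * (1 - p))
        ≤ (1 / p) ^ (j + 1) * (p * 1) := by
          gcongr
          · exact mul_nonneg hp0.le (by linarith)
          · linarith
      _ = D := by
          rw [pow_succ, ← hD]
          field_simp
  have hk1 : (1 : ℝ) ≤ (j + 1 : ℕ) := by exact_mod_cast hk
  generalize ((j + 1 : ℕ) : ℝ) = k at *
  have hrhs : D * k * (12 * L ^ 2) ≤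
      2 * (6 * k / (p ^ (j + 1 - 1) * (1 - 2 * p)) * L ^ 2) := by
    have : 2 * (6 * k / (p ^ (j + 1 - 1) * (1 - 2 * p)) * L ^ 2) =
        D * k * (12 * L ^ 2) / (1 - 2 * p) := by
      rw [hD, Nat.add_sub_cancel, div_pow, one_pow]
      have : 1 - 2 * p ≠ 0 := by linarith
      field_simp
      ring
    rw [this]
    -- The denominator `1 - 2 * p` lies in `(0, 1]`, so it only weakens the bound.
    exact le_div_self (by positivity) (by linarith) (by linarith)
  refine le_trans ?_ hrhs
  calc (3 + 2 * L) / 4 + (3 + Real.log (((1 - p) / p) ^ (j + 1))) *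
        (((1 - p) / p) ^ (j + 1) * (p * (1 - p)))
      ≤ (3 + 2 * L) / 4 + (3 + k * L) * D := by
        refine add_le_add le_rfl (mul_le_mul (by linarith) hKb ?_ (by nlinarith))
        exact mul_nonneg (pow_nonneg hr0.le _) (mul_nonneg hp0.le (by linarith))
    _ ≤ D * k * ((3 + 2 * L) / 4) + D * k * (3 + L) := by
        have hDk : 1 ≤ D * k := one_le_mul_of_one_le_of_one_le hD1 hk1
        have h1 := mul_le_mul_of_nonneg_right hDk (by linarith : 0 ≤ (3 + 2 * L) / 4)
        have h2 := mul_le_mul_of_nonneg_left hk1 (by linarith : 0 ≤ D)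
        nlinarith
    _ = D * k * ((3 + 2 * L) / 4 + 3 + L) := by ring
    _ ≤ D * k * (12 * L ^ 2) := by
        refine mul_le_mul_of_nonneg_left ?_ (by positivity)
        -- What remains is `15 / 4 + 3 / 2 * L ≤ 12 * L ^ 2`, which holds for `L ≥ 0.69`, a lower
        -- bound coming from `p < 1 / 2`.
        nlinarith

theorem mainTheorem8 (n k : ℕ) (hk : 1 ≤ k) (p : unitInterval) (hp0 : 0 < (p : ℝ))
    (hp : (p : ℝ) < 1 / 2)
    (μ : Measure (Fin n → Fin 2)) [IsProbabilityMeasure μ]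
    (S : Set (Fin n → Fin 2)) (hμS : μ Sᶜ = 0)
    (hS : ∀ x ∈ S, ∀ y ∈ S, hammingDist x y ≤ k) :
    SatisfiesLSI ⊤ discreteGamma (mixture (bernoulliPair p) μ)
        (6 * (k : ℝ) / ((p : ℝ) ^ (k - 1) * (1 - 2 * (p : ℝ))) * Real.log (1 / (p : ℝ)) ^ 2) ∧
      logSobolevConst ⊤ discreteGamma (mixture (bernoulliPair p) μ) ≤
        ENNReal.ofReal
          (6 * (k : ℝ) / ((p : ℝ) ^ (k - 1) * (1 - 2 * (p : ℝ))) *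
            Real.log (1 / (p : ℝ)) ^ 2) := by
  have hfin := isFiniteMeasure_mixture p μ
  have hC : 0 ≤ 6 * (k : ℝ) / ((p : ℝ) ^ (k - 1) * (1 - 2 * (p : ℝ))) *
      Real.log (1 / (p : ℝ)) ^ 2 := by
    have : 0 < 1 - 2 * (p : ℝ) := by linarith
    positivity
  have hq : 0 < 1 - (p : ℝ) := by linarith
  have hp1 : 1 ≤ 1 / (p : ℝ) := by
    rw [le_div_iff₀ hp0]
    linarith
  have hr1 : 1 ≤ (1 - (p : ℝ)) / p := by
    rw [le_div_iff₀ hp0]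
    linarith
  have key : SatisfiesLSI ⊤ discreteGamma (mixture (bernoulliPair p) μ)
      (6 * (k : ℝ) / ((p : ℝ) ^ (k - 1) * (1 - 2 * (p : ℝ))) * Real.log (1 / (p : ℝ)) ^ 2) := by
    intro f _
    rw [entropy_eq_weightedEntropy, integral_eq_sum_real_singleton]
    simp_rw [mixture_real_singleton]
    set v : Fin 2 → Fin 2 → ℝ := fun a b => if a = b then 1 - (p : ℝ) else p with hv
    have hvp (a b) : (p : ℝ) ≤ v a b := by
      simp only [hv]
      split_ifs <;> linarith
    have hv0 (a b) : 0 ≤ v a b := hp0.le.trans (hvp a b)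
    have hv1 (a) : v a 0 + v a 1 = 1 := by fin_cases a <;> simp [hv]
    have hvb (a) : v a 0 * v a 1 ≤ (p : ℝ) * (1 - p) := by
      fin_cases a <;> simp [hv, mul_comm]
    have hvr (a a' b) : v a b ≤ (1 - (p : ℝ)) / p * v a' b := by
      have h1 : v a b ≤ 1 - p := by
        simp only [hv]
        split_ifs <;> linarith
      have h2 := mul_le_mul_of_nonneg_left (hvp a' b) (by positivity : 0 ≤ (1 - (p : ℝ)) / p)
      rw [div_mul_cancel₀ _ hp0.ne'] at h2
      exact h1.trans h2
    have hmem (x) (hx : μ.real {x} ≠ 0) : x ∈ S := by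
      by_contra h
      refine hx ?_
      rw [measureReal_def, measure_mono_null (Set.singleton_subset_iff.2 h) hμS,
        ENNReal.toReal_zero]
    have hm1 : ∑ x, μ.real {x} = 1 := by simp
    have hG : 0 ≤ ∑ y, (∑ x, μ.real {x} * prodWeight (fun i => v (x i)) y) *
        discreteGamma f y :=
      Finset.sum_nonneg fun y _ => mul_nonneg
        (Finset.sum_nonneg fun x _ => mul_nonneg measureReal_nonneg
          (prodWeight_nonneg (fun i a => hv0 _ _) y))
        (Finset.sum_nonneg fun i _ => sq_nonneg _)
    have hlog := Real.log_nonneg hp1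
    have hls (x : Fin n → Fin 2) :
        weightedEntropy (prodWeight fun i => v (x i)) (fun y => f y ^ 2) ≤
          (3 + 2 * Real.log (1 / (p : ℝ))) / 4 *
            ∑ y, prodWeight (fun i => v (x i)) y * discreteGamma f y :=
      weightedEntropy_prodWeight_sq_le (by positivity) (fun i => hv0 (x i)) (fun i => hv1 (x i))
        (fun i g hg => weightedEntropy_sq_two_point_le hp0 (hvp (x i)) (hv1 (x i)) hg) f
    have hP (x : Fin n → Fin 2) :
        ∑ y, prodWeight (fun i => v (x i)) y * f y ^ 2 -
            (∑ y, prodWeight (fun i => v (x i)) y * f y) ^ 2 ≤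
          (p : ℝ) * (1 - p) * ∑ y, prodWeight (fun i => v (x i)) y * discreteGamma f y :=
      prodWeight_variance_le (fun i => hv0 (x i)) (fun i => hv1 (x i)) (fun i => hvb (x i))
        (mul_nonneg hp0.le hq.le) f
    have hK (x x' : Fin n → Fin 2) (hx : μ.real {x} ≠ 0) (hx' : μ.real {x'} ≠ 0)
        (y : Fin n → Fin 2) : prodWeight (fun i => v (x i)) y ≤
          ((1 - (p : ℝ)) / p) ^ k * prodWeight (fun i => v (x' i)) y :=
      (prodWeight_le_pow_hammingDist_mul hv0 hvr x x' y).trans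
        (mul_le_mul_of_nonneg_right
          (pow_le_pow_right₀ hr1 (hS x (hmem x hx) x' (hmem x' hx')))
          (prodWeight_nonneg (fun i => hv0 (x' i)) y))
    have h := weightedEntropy_mixture_sq_le (m := fun x => μ.real {x})
      (W := fun x => prodWeight fun i => v (x i)) (fun x => measureReal_nonneg) hm1
      (fun x => prodWeight_nonneg fun i => hv0 (x i))
      (fun x => sum_prodWeight fun i => hv1 (x i)) (one_le_pow₀ hr1) hK hls hP
    exact h.trans (mul_le_mul_of_nonneg_right (mixture_constant_le hk hp0 hp) hG)
  refine ⟨key, ?_⟩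
  exact iInf₂_le (Real.toNNReal _) (by rwa [Real.coe_toNNReal _ hC])
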